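/- Let $(A,\nu,T)$ be a measure-preserving dynamical system on a probability space. Let $n\ge 1$ and $r\in[1,+\infty]$, and let $M$ be an $n$-dimensional (Hausdorff, second countable) $\mathcal C^r$ manifold. Let $\widetilde A:=(A\times[0,1])/_{(x,1)\sim(T(x),0)}$, equipped with the measure $\tilde\nu$ which is $\nu\otimes\mathrm{Leb}$ on the fundamental domain $A\times[0,1)$. For $w>0$ let $(g^w_t)_{t\ge0}$ be the suspension semi-flow $g^w_t[(x,s)]=[(x,s+wt)]$ on $\widetilde A$, where $(x,u+1)\sim(T(x),u)$ for all $u\ge 0$. For $v\in\mathcal C^r(M,\mathbb R_+^*)$, define a semi-flow on $\Omega:=\widetilde A\times M$ by $g^v_t(p,y):=(g^{v(y)}_t(p),y)$, $t\ge0$. Call a probability measure $\mu$ on $\Omega$ an absolutely continuous compatible measure if $\mu=\tilde\nu\otimes\tilde\mu$ for some probability measure $\tilde\mu$ on $M$ which is absolutely continuous with respect to the Lebesgue measure class of $M$. Endow $\mathcal C^r(M,\mathbb R_+^*)$ with the $\mathcal C^r$ topology: uniform convergence, on compact subsets of the domains of charts, of all derivatives of order at most $r$ (of all derivatives if $r=\infty$).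 Then there is a Baire generic (i.e. comeagre) set of functions $v\in\mathcal C^r(M,\mathbb R_+^*)$ such that, for every absolutely continuous compatible measure $\mu$, the system $(\Omega,\mu,(g^v_t)_{t\ge0})$ exhibits Keplerian shear: $(g^v_t)_{t\ge 0}$ preserves $\mu$, and for all $f\in\mathbb L^2(\Omega,\mu)$, $$\lim_{t\to+\infty} f\circ g^v_t=\mathbb E_\mu(f\mid\mathcal I)\quad\text{weakly in }\mathbb L^2(\Omega,\mu),$$ where $\mathcal I$ is the $\sigma$-algebra of measurable sets $B$ such that $(g^v_t)^{-1}(B)=B$ for all $t\ge0$. -/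

import Mathlib

open MeasureTheory Filter Topology Set
open scoped NNReal Manifold ContDiff ComplexConjugate

noncomputable section

namespace StretchedBirkhoff

/-! ### Keplerian shear -/

section Shear

variable {Ω : Type*} [MeasurableSpace Ω]

/-- The invariant σ-algebra of a semi-flow `(g_t)_{t ≥ 0}`: the measurable sets `B` with
`g_t ⁻¹(B) = B` for every `t ≥ 0`. -/
@[reducible] def invariantSigmaAlgebra (g : ℝ≥0 → Ω → Ω) : MeasurableSpace Ω :=
  ⨅ t : ℝ≥0, MeasurableSpace.invariants (g t)

/-- The semi-flow `(g_t)` preserves the probability measure `μ`, and for every `f ∈ L²(μ)` the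
functions `f ∘ g_t` converge to `𝔼_μ(f | 𝓘)` weakly in `L²(μ)` as `t → +∞`; weak convergence is
tested against all `h ∈ L²(μ)`, the functions being complex valued. -/
structure KeplerianShear (μ : Measure Ω) (g : ℝ≥0 → Ω → Ω) : Prop where
  isProbabilityMeasure : IsProbabilityMeasure μ
  measurePreserving : ∀ t, MeasurePreserving (g t) μ μ
  tendsto_weakly : ∀ f h : Ω → ℂ, MemLp f 2 μ → MemLp h 2 μ →
    Tendsto (fun t : ℝ≥0 => ∫ x, conj (h x) * f (g t x) ∂μ) atTop
      (𝓝 (∫ x, conj (h x) * (μ[f | invariantSigmaAlgebra g]) x ∂μ))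

end Shear

/-! ### Suspensions with constant roof `1` -/

section Suspension

variable {A : Type*}

/-- The gluing `(x, 1) ∼ (T x, 0)` on `A × [0, 1]`. -/
def Glue (T : A → A) (p q : A × Icc (0 : ℝ) 1) : Prop :=
  p.2 = 1 ∧ q = (T p.1, 0)

/-- The space `(A × [0, 1]) / ((x, 1) ∼ (T x, 0))`. -/
def Suspension (T : A → A) : Type _ := Quot (Glue T)

instance [MeasurableSpace A] (T : A → A) : MeasurableSpace (Suspension T) :=
  inferInstanceAs (MeasurableSpace (Quot (Glue T)))

/-- The class `[(x, s)]`. -/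
def Suspension.mk (T : A → A) (p : A × Icc (0 : ℝ) 1) : Suspension T := Quot.mk (Glue T) p

/-- The class `[(x, u)]` of a point of `A × [0, ∞)`, where `(x, u + 1) ∼ (T x, u)`: it is
the class of `(T^⌊u⌋ x, u - ⌊u⌋)`. Only used for `u ≥ 0`. -/
def Suspension.point (T : A → A) (x : A) (u : ℝ) : Suspension T :=
  Suspension.mk T (T^[⌊u⌋₊] x, ⟨Int.fract u, Int.fract_nonneg u, (Int.fract_lt_one u).le⟩)

theorem Suspension.point_one_add (T : A → A) (x : A) {u : ℝ} (hu : 0 ≤ u) :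
    Suspension.point T x (1 + u) = Suspension.point T (T x) u := by
  have h : ⌊1 + u⌋₊ = ⌊u⌋₊ + 1 := by
    rw [add_comm, Nat.floor_add_one hu]
  simp [Suspension.point, h]

/-- The translation `[(x, s)] ↦ [(x, s + τ)]`, for `τ ≥ 0`. The suspension semi-flow with
speed `w` at time `t` is the translation by `τ = w t`. -/
def Suspension.translate (T : A → A) (τ : ℝ≥0) : Suspension T → Suspension T :=
  Quot.lift (fun p => Suspension.point T p.1 ((p.2 : ℝ) + τ)) (by
    rintro ⟨x, s⟩ q ⟨hs, rfl⟩
    obtain rfl : s = 1 := hs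
    simpa using Suspension.point_one_add T x τ.coe_nonneg)

/-- The measure `ν ⊗ Leb` on the fundamental domain `A × [0, 1)`, seen on the suspension. (The
slice `A × {1}` is negligible for `ν ⊗ Leb` on `A × [0, 1]`.) -/
def suspensionMeasure [MeasurableSpace A] (T : A → A) (ν : Measure A) :
    Measure (Suspension T) :=
  (ν.prod (volume : Measure (Icc (0 : ℝ) 1))).map (Suspension.mk T)

end Suspension

/-! ### The base manifold -/

section Base

variable (n : ℕ) (r : ℕ∞) (M : Type*) [TopologicalSpace M]
  [ChartedSpace (EuclideanSpace ℝ (Fin n)) M]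

variable {M} in
/-- `S` has zero Lebesgue measure in every chart. On a `C^1` manifold this does not depend on
the choice of the atlas. -/
def LebesgueNull (S : Set M) : Prop :=
  ∀ e ∈ atlas (EuclideanSpace ℝ (Fin n)) M, volume (e '' (S ∩ e.source)) = 0

variable {M} in
/-- `m ≪ Leb` on a manifold. -/
def AbsolutelyContinuousLebesgue [MeasurableSpace M] (m : Measure M) : Prop :=
  ∀ S : Set M, LebesgueNull n S → m S = 0

/-- The `C^r` topology on `C^r(M, ℝ)`: all derivatives up to order `r` (all derivatives, if
`r = ∞`), read in charts, converge uniformly on the compact subsets of the domains of charts. -/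
@[reducible] def crTopology : TopologicalSpace C^r⟮𝓡 n, M; ℝ⟯ :=
  ⨅ e ∈ atlas (EuclideanSpace ℝ (Fin n)) M, ⨅ k : ℕ, ⨅ _ : (k : ℕ∞) ≤ r,
    TopologicalSpace.induced
      (fun f : C^r⟮𝓡 n, M; ℝ⟯ =>
        UniformOnFun.ofFun {K : Set (EuclideanSpace ℝ (Fin n)) | IsCompact K ∧ K ⊆ e.target}
          (iteratedFDeriv ℝ k (fun z => f (e.symm z))))
      inferInstance

/-- The space `C^r(M, ℝ₊*)`. -/
def RoofFunction : Type _ := {v : C^r⟮𝓡 n, M; ℝ⟯ // ∀ y, 0 < v y}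

instance : TopologicalSpace (RoofFunction n r M) :=
  TopologicalSpace.induced Subtype.val (crTopology n r M)

variable {n r M}

/-- The value `v(y) > 0`, as a nonnegative real number. -/
def RoofFunction.speed (v : RoofFunction n r M) (y : M) : ℝ≥0 := Real.toNNReal (v.1 y)

variable {A : Type*}

/-- The semi-flow `g_t^v(p, y) = (g_t^{v(y)}(p), y)` on `Ω = Ã × M`. -/
def stretchedFlow (T : A → A) (v : RoofFunction n r M) (t : ℝ≥0) (p : Suspension T × M) :
    Suspension T × M :=
  (Suspension.translate T (v.speed p.2 * t) p.1, p.2)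

variable (n) in
/-- `μ` is an absolutely continuous compatible measure on `Ω = Ã × M`: it is `ν̃ ⊗ m` for an
absolutely continuous probability measure `m` on `M`. -/
def IsAbsolutelyContinuousCompatible [MeasurableSpace A] [MeasurableSpace M] (T : A → A)
    (ν : Measure A) (μ : Measure (Suspension T × M)) : Prop :=
  ∃ m : Measure M, IsProbabilityMeasure m ∧ AbsolutelyContinuousLebesgue n m ∧
    μ = (suspensionMeasure T ν).prod m

end Base

end StretchedBirkhoff

end

namespace StretchedBirkhoff

/-! ### The suspension flow: semigroup law, joint measurability, invariant measure. -/

section SuspensionFlow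

variable {A : Type*}

/-! The proof has a dynamical and a generic half, joined by one condition: the law of the speed `v`
under `m` is absolutely continuous on ℝ.

Dynamics (`MeasurePreservingSemiflow.keplerianShear`). Let V_s be the Koopman operator of the fibre
flow at constant time s. Delaying the stretched flow by s amounts to replacing the speed w by w +
s/t, that is, to translating the density of its law by s/t. Translations are continuous in L¹, so
coboundaries V_s e - e of rectangle indicators tend weakly to 0. On the range of the projection P
onto invariant functions there is nothing to prove. These two families are total: if q is orthogonal
to both, then Pq = 0 and V_s* q = q, hence V_s q = q because V_s is an isometry. The level sets of q
are then almost invariant under the fibre flow, so they agree a.e. with strictly invariant sets, on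
which Pq = 0 makes q integrate to 0. Thus q = 0.

Genericity (`eventually_residual_map_absolutelyContinuous`). Off its critical points `v` is a
submersion and pulls null sets back to null sets, so a null critical set suffices. Having critical
set of volume < ε in a given chart ball is an open condition on `v`; it is dense because, along v +
aθ with dθ ≠ 0 on the ball, the critical sets are pairwise disjoint. Countably many balls and values
of ε are enough. Only first derivatives are involved, and Sard's theorem is not needed. -/

theorem Suspension.translate_point (T : A → A) (x : A) {u : ℝ} (hu : 0 ≤ u) (τ : ℝ≥0) :
    Suspension.translate T τ (Suspension.point T x u) = Suspension.point T x (u + τ) := by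
  change Suspension.point T (T^[⌊u⌋₊] x) (Int.fract u + τ) = _
  have h : u + τ = (Int.fract u + τ) + (⌊u⌋₊ : ℝ) := by
    have := Int.floor_add_fract u
    rw [← natCast_floor_eq_intCast_floor hu] at this
    linarith
  have h0 : (0 : ℝ) ≤ Int.fract u + τ := add_nonneg (Int.fract_nonneg u) τ.coe_nonneg
  have h1 : ⌊u + τ⌋₊ = ⌊Int.fract u + (τ : ℝ)⌋₊ + ⌊u⌋₊ := by
    rw [h, Nat.floor_add_natCast h0]
  have h2 : Int.fract (u + τ) = Int.fract (Int.fract u + (τ : ℝ)) := by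
    rw [h, Int.fract_add_natCast]
  simp only [Suspension.point, h1, h2, Function.iterate_add_apply]

theorem Suspension.translate_add (T : A → A) (a b : ℝ≥0) (p : Suspension T) :
    Suspension.translate T (a + b) p
      = Suspension.translate T a (Suspension.translate T b p) := by
  induction p using Quot.ind with
  | mk p =>
    change Suspension.point T p.1 ((p.2 : ℝ) + ((a + b : ℝ≥0) : ℝ))
      = Suspension.translate T a (Suspension.point T p.1 ((p.2 : ℝ) + b))
    rw [Suspension.translate_point T _ (add_nonneg p.2.2.1 b.coe_nonneg)]
    push_cast
    congr 1
    ring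

open Classical in
/-- The representative in `A × [0, 1)` of a point of the suspension. -/
noncomputable def Suspension.rep (T : A → A) : Suspension T → A × Icc (0 : ℝ) 1 :=
  Quot.lift (fun p => if p.2 = 1 then (T p.1, 0) else p) (by
    rintro p q ⟨hp, rfl⟩
    simp [hp])

/-- Factoring through the measurable section `rep` gives measurability jointly in time and point,
which the quotient σ-algebra does not provide directly on a product. -/
theorem Suspension.translate_eq_point_rep (T : A → A) (τ : ℝ≥0) (p : Suspension T) :
    Suspension.translate T τ p = Suspension.point T (Suspension.rep T p).1
      (((Suspension.rep T p).2 : ℝ) + τ) := by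
  induction p using Quot.ind with
  | mk p =>
    obtain ⟨x, s⟩ := p
    change Suspension.point T x ((s : ℝ) + τ) = _
    by_cases hs : s = 1
    · subst hs
      simpa [Suspension.rep] using Suspension.point_one_add T x τ.coe_nonneg
    · simp [Suspension.rep, hs]

variable [MeasurableSpace A] {T : A → A}

theorem Suspension.measurable_mk : Measurable (Suspension.mk T) := measurable_quot_mk

theorem Suspension.measurable_rep (hT : Measurable T) :
    Measurable (Suspension.rep T) := by
  classical
  have h : Measurable fun p : A × Icc (0 : ℝ) 1 => if p.2 = 1 then (T p.1, 0) else p :=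
    Measurable.ite (measurable_snd (measurableSet_singleton 1))
      ((hT.comp measurable_fst).prodMk measurable_const) measurable_id
  exact fun s hs => h hs

theorem measurable_uncurry_iterate (hT : Measurable T) :
    Measurable fun q : ℕ × A => T^[q.1] q.2 :=
  measurable_from_prod_countable_right fun k => hT.iterate k

theorem Suspension.measurable_point (hT : Measurable T) :
    Measurable fun q : A × ℝ => Suspension.point T q.1 q.2 := by
  refine Suspension.measurable_mk.comp (Measurable.prodMk ?_ ?_)
  · exact (measurable_uncurry_iterate hT).comp
      ((Nat.measurable_floor.comp measurable_snd).prodMk measurable_fst)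
  · exact (measurable_fract.comp measurable_snd).subtype_mk

theorem Suspension.measurable_translate (hT : Measurable T) :
    Measurable fun q : ℝ≥0 × Suspension T => Suspension.translate T q.1 q.2 := by
  simp only [Suspension.translate_eq_point_rep]
  have h := (Suspension.measurable_rep hT).comp
    (measurable_snd : Measurable (Prod.snd : ℝ≥0 × Suspension T → _))
  exact (Suspension.measurable_point hT).comp (h.fst.prodMk
    ((measurable_subtype_coe.comp h.snd).add (measurable_coe_nnreal_real.comp measurable_fst)))

instance (ν : Measure A) [IsProbabilityMeasure ν] :
    IsProbabilityMeasure (suspensionMeasure T ν) :=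
  Measure.isProbabilityMeasure_map Suspension.measurable_mk.aemeasurable

/-- Rotations of the circle preserve Lebesgue measure. No measurability of `b` is required. -/
theorem setLIntegral_Icc_fract_add (b : ℝ → ENNReal) (τ : ℝ) :
    ∫⁻ s in Icc (0 : ℝ) 1, b (Int.fract (s + τ)) = ∫⁻ s in Icc (0 : ℝ) 1, b s := by
  let F : UnitAddCircle → ENNReal :=
    Function.Periodic.lift (f := fun s : ℝ => b (Int.fract s)) (c := (1 : ℝ))
      (fun s => by simp)
  have hF : ∀ s : ℝ, F s = b (Int.fract s) := fun s => rfl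
  have h1 := UnitAddCircle.lintegral_preimage τ F
  have h0 := UnitAddCircle.lintegral_preimage 0 F
  rw [zero_add] at h0
  simp only [hF] at h0 h1
  calc ∫⁻ s in Icc (0 : ℝ) 1, b (Int.fract (s + τ))
      = ∫⁻ s in Ioc (0 : ℝ) 1, b (Int.fract (s + τ)) := setLIntegral_congr Ioc_ae_eq_Icc.symm
    _ = ∫⁻ s in Ioc τ (τ + 1), b (Int.fract s) := by
        have := (measurePreserving_add_right (volume : Measure ℝ) τ).setLIntegral_comp_preimage_emb
          (MeasurableEquiv.addRight τ).measurableEmbedding (fun s => b (Int.fract s))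
          (Ioc τ (τ + 1))
        rw [← this]
        simp [add_comm τ 1]
    _ = ∫⁻ s in Ioc (0 : ℝ) 1, b (Int.fract s) := h1.trans h0.symm
    _ = ∫⁻ s in Ico (0 : ℝ) 1, b (Int.fract s) := setLIntegral_congr Ico_ae_eq_Ioc.symm
    _ = ∫⁻ s in Ico (0 : ℝ) 1, b s :=
        setLIntegral_congr_fun measurableSet_Ico fun s hs => by
          simp only [Int.fract_eq_self.2 hs]
    _ = ∫⁻ s in Icc (0 : ℝ) 1, b s := setLIntegral_congr Ico_ae_eq_Icc

theorem suspensionMeasure_apply {ν : Measure A} [IsProbabilityMeasure ν]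
    {B : Set (Suspension T)} (hB : MeasurableSet B) :
    suspensionMeasure T ν B = ∫⁻ s : Icc (0 : ℝ) 1, ν {x | Suspension.mk T (x, s) ∈ B} := by
  rw [suspensionMeasure, Measure.map_apply Suspension.measurable_mk hB,
    Measure.prod_apply_symm (Suspension.measurable_mk hB)]
  rfl

/-- Slice at height s: the translation applies an iterate of `T`, which preserves `ν`, and moves the
height to the fractional part of s + τ, a rotation. -/
theorem measurePreserving_translate {ν : Measure A} [IsProbabilityMeasure ν]
    (hT : MeasurePreserving T ν ν) (τ : ℝ≥0) :
    MeasurePreserving (Suspension.translate T τ) (suspensionMeasure T ν)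
      (suspensionMeasure T ν) := by
  have hm : Measurable (Suspension.translate T τ) :=
    (Suspension.measurable_translate hT.measurable).comp measurable_prodMk_left
  refine ⟨hm, Measure.ext fun B hB => ?_⟩
  rw [Measure.map_apply hm hB, suspensionMeasure_apply (hm hB), suspensionMeasure_apply hB]
  let b : ℝ → ENNReal := fun s =>
    ν {x | Suspension.mk T (x, ⟨Int.fract s, Int.fract_nonneg s, (Int.fract_lt_one s).le⟩) ∈ B}
  have key : ∀ s : ℝ, ν {x | Suspension.point T x s ∈ B} = b s := by
    intro s
    have hmeas : MeasurableSet {x | Suspension.mk T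
        (x, ⟨Int.fract s, Int.fract_nonneg s, (Int.fract_lt_one s).le⟩) ∈ B} :=
      (Suspension.measurable_mk.comp measurable_prodMk_right) hB
    exact (hT.iterate ⌊s⌋₊).measure_preimage hmeas.nullMeasurableSet
  have hb : ∀ s : ℝ, b (Int.fract s) = b s := fun s => by simp only [b, Int.fract_fract]
  -- At s = 1 the fractional part is 0 and the two slices may differ, but this is a single point.
  have hae : ∀ᵐ s : Icc (0 : ℝ) 1, ν {x | Suspension.mk T (x, s) ∈ B} = b s := by
    have : ∀ᵐ s : Icc (0 : ℝ) 1, s ≠ 1 := by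
      simp only [ae_iff, Measure.Subtype.volume_def, ne_eq, not_not, ofPred_eq_eq_singleton]
      rw [(MeasurableEmbedding.subtype_coe measurableSet_Icc).comap_apply]
      simp
    filter_upwards [this] with s hs
    have h1 : (s : ℝ) < 1 := lt_of_le_of_ne s.2.2 fun h => hs (Subtype.ext h)
    have h2 : Int.fract (s : ℝ) = s := Int.fract_eq_self.2 ⟨s.2.1, h1⟩
    simp only [b, h2]
  rw [lintegral_congr_ae hae]
  have hlhs : ∀ s : Icc (0 : ℝ) 1, ν {x | Suspension.mk T (x, s) ∈ Suspension.translate T τ ⁻¹' B}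
      = b (Int.fract ((s : ℝ) + τ)) := fun s => by
    rw [hb, ← key]; rfl
  simp only [hlhs]
  rw [show (volume : Measure (Icc (0 : ℝ) 1)) = Measure.comap Subtype.val volume from rfl,
    lintegral_subtype_comap measurableSet_Icc (fun s : ℝ => b (Int.fract (s + τ))),
    lintegral_subtype_comap measurableSet_Icc b, setLIntegral_Icc_fract_add]

end SuspensionFlow

/-! ### Averaging over an absolutely continuous law of speeds. -/

section Averaging

/-- Translations form a continuous family of measure-preserving maps in the compact-open topology,
and composition with such maps is continuous in L¹. -/
theorem tendsto_integral_norm_translate_sub {ρ : ℝ → ℝ} (hρ : Integrable ρ) :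
    Tendsto (fun a : ℝ => ∫ x, ‖ρ (x - a) - ρ x‖) (𝓝 0) (𝓝 0) := by
  let G : ℝ → C(ℝ, ℝ) := fun a => ⟨fun x => x - a, by fun_prop⟩
  have hG : Continuous G :=
    (ContinuousMap.curry ⟨fun p : ℝ × ℝ => p.2 - p.1, by fun_prop⟩).continuous
  have hmp : ∀ a, MeasurePreserving (G a) (volume : Measure ℝ) volume := fun a =>
    measurePreserving_sub_right volume a
  have hlim := (tendsto_const_nhds (x := hρ.toL1 ρ) (f := 𝓝 (0 : ℝ))).compMeasurePreservingLp
    (hG.tendsto 0) hmp (hmp 0) ENNReal.one_ne_top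
  have hzero : Lp.compMeasurePreserving (G 0) (hmp 0) (hρ.toL1 ρ) = hρ.toL1 ρ := by
    refine Lp.ext ?_
    filter_upwards [Lp.coeFn_compMeasurePreserving (hρ.toL1 ρ) (hmp 0)] with x hx
    rw [hx]
    simp [G]
  rw [hzero, tendsto_iff_norm_sub_tendsto_zero] at hlim
  refine hlim.congr fun a => ?_
  rw [L1.norm_eq_integral_norm]
  refine integral_congr_ae ?_
  filter_upwards [Lp.coeFn_sub (Lp.compMeasurePreserving (G a) (hmp a) (hρ.toL1 ρ)) (hρ.toL1 ρ),
    Lp.coeFn_compMeasurePreserving (hρ.toL1 ρ) (hmp a), hρ.coeFn_toL1,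
    (hmp a).quasiMeasurePreserving.ae hρ.coeFn_toL1] with x h1 h2 h3 h4
  rw [h1, Pi.sub_apply, h2, h3, Function.comp_apply, h4]
  rfl

/-- If a bounded function is evaluated along dilations distributed according to an absolutely
continuous law, a shift of its argument has no effect in the limit. -/
theorem tendsto_integral_dilation_shift_sub {κ : Measure ℝ} [IsFiniteMeasure κ]
    (hκ : κ ≪ volume) {C : ℝ → ℝ} (hC : Measurable C) (hb : ∀ x, ‖C x‖ ≤ 1) (s : ℝ) :
    Tendsto (fun t : ℝ => ∫ w, (C (w * t + s) - C (w * t)) ∂κ) atTop (𝓝 0) := by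
  set ρ : ℝ → ℝ := fun w => (κ.rnDeriv volume w).toReal
  have hρ : Integrable ρ := Measure.integrable_toReal_rnDeriv
  have hlim : Tendsto (fun t : ℝ => ∫ x, ‖ρ (x - s / t) - ρ x‖) atTop (𝓝 0) :=
    (tendsto_integral_norm_translate_sub hρ).comp (tendsto_const_nhds.div_atTop tendsto_id)
  refine squeeze_zero_norm' ?_ hlim
  filter_upwards [eventually_gt_atTop 0] with t ht
  have hbd : ∀ {φ : ℝ → ℝ} {ψ : ℝ → ℝ}, Integrable φ → Measurable ψ →
      Integrable fun w => φ w * C (ψ w) := fun hφ hψ =>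
    hφ.mul_bdd (c := 1) (hC.comp hψ).aestronglyMeasurable (.of_forall fun w => hb _)
  rw [← integral_rnDeriv_smul hκ]
  have hsub : Integrable fun w => ρ (w - s / t) := hρ.comp_sub_right _
  -- The substitution w ↦ w - s/t moves the shift from the argument of `C` to the density.
  have e1 : ∫ w, ρ w * C (w * t + s) = ∫ w, ρ (w - s / t) * C (w * t) := by
    rw [← integral_sub_right_eq_self (fun w => ρ w * C (w * t + s)) (s / t)]
    refine integral_congr_ae (.of_forall fun w => ?_)
    have : (w - s / t) * t + s = w * t := by field_simp; ring
    simp only [this]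
  calc ‖∫ w, (κ.rnDeriv volume w).toReal • (C (w * t + s) - C (w * t))‖
      = ‖∫ w, (ρ (w - s / t) - ρ w) * C (w * t)‖ := by
        congr 1
        simp only [smul_eq_mul, mul_sub, sub_mul]
        rw [integral_sub (hbd hρ (by fun_prop)) (hbd hρ (by fun_prop)),
          integral_sub (hbd hsub (by fun_prop)) (hbd hρ (by fun_prop)), e1]
    _ ≤ ∫ w, ‖ρ (w - s / t) - ρ w‖ := by
        refine norm_integral_le_of_norm_le (hsub.sub hρ).norm (.of_forall fun w => ?_)
        rw [norm_mul]
        exact mul_le_of_le_one_right (norm_nonneg _) (hb _)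

/-- A bounded family of additive, homogeneous functionals tends to zero as soon as it does so on
a total set. -/
theorem tendsto_zero_of_total {E ι : Type*} [NormedAddCommGroup E] [InnerProductSpace ℂ E]
    [CompleteSpace E] {l : Filter ι} (φ : ι → E → ℂ) (c : ℝ)
    (hadd : ∀ t x y, φ t (x + y) = φ t x + φ t y)
    (hsmul : ∀ t (a : ℂ) x, ‖φ t (a • x)‖ = ‖a‖ * ‖φ t x‖)
    (hbd : ∀ t x, ‖φ t x‖ ≤ c * ‖x‖) (S : Set E)
    (hS : ∀ q : E, (∀ x ∈ S, inner ℂ x q = 0) → q = 0)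
    (hφ : ∀ x ∈ S, Tendsto (φ · x) l (𝓝 0)) (x : E) : Tendsto (φ · x) l (𝓝 0) := by
  have hspan : ∀ y ∈ Submodule.span ℂ S, Tendsto (φ · y) l (𝓝 0) := by
    intro y hy
    induction hy using Submodule.span_induction with
    | mem y hy => exact hφ y hy
    | zero =>
      have h0 : ∀ t, φ t 0 = 0 := fun t => norm_le_zero_iff.1 (by simpa using hbd t 0)
      simpa [h0] using tendsto_const_nhds
    | add y z _ _ hy hz => simpa [hadd] using hy.add hz
    | smul a y _ hy =>
      -- Homogeneity in norm suffices, so both the linear and the conjugate-linear slot of the inner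
      -- product are covered.
      rw [tendsto_zero_iff_norm_tendsto_zero] at hy ⊢
      simpa [hsmul] using hy.const_mul ‖a‖
  have hdense : (Submodule.span ℂ S).topologicalClosure = ⊤ := by
    rw [Submodule.topologicalClosure_eq_top_iff, Submodule.eq_bot_iff]
    intro q hq
    exact hS q fun x hx => (Submodule.mem_orthogonal _ _).1 hq x (Submodule.subset_span hx)
  have hx : x ∈ closure (Submodule.span ℂ S : Set E) := by
    rw [← Submodule.topologicalClosure_coe, hdense]
    trivial
  rw [Metric.tendsto_nhds]
  intro ε hε
  obtain ⟨y, hy, hxy⟩ := Metric.mem_closure_iff.1 hx (ε / 2 / (|c| + 1)) (by positivity)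
  filter_upwards [Metric.tendsto_nhds.1 (hspan y hy) (ε / 2) (by positivity)] with t ht
  rw [dist_zero_right] at ht ⊢
  have h1 : φ t x = φ t (x - y) + φ t y := by rw [← hadd, sub_add_cancel]
  have h2 : ‖φ t (x - y)‖ ≤ ε / 2 := by
    rw [dist_eq_norm, lt_div_iff₀ (by positivity)] at hxy
    calc ‖φ t (x - y)‖ ≤ c * ‖x - y‖ := hbd t _
      _ ≤ (|c| + 1) * ‖x - y‖ := by
        gcongr
        linarith [le_abs_self c]
      _ ≤ ε / 2 := by rw [mul_comm]; exact hxy.le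
  calc ‖φ t x‖ ≤ ‖φ t (x - y)‖ + ‖φ t y‖ := h1 ▸ norm_add_le _ _
    _ < ε := by linarith

end Averaging

/-! ### Skew products over the identity. -/

section Skew

variable {X Y : Type*} [MeasurableSpace X] [MeasurableSpace Y]

/-- Indicators of rectangles are total in `L²`. -/
theorem eq_zero_of_inner_indicator_prod_eq_zero {κ : Measure X} [IsProbabilityMeasure κ]
    {m : Measure Y} [IsProbabilityMeasure m] (q : Lp ℂ 2 (κ.prod m))
    (hq : ∀ (B : Set X) (D : Set Y) (hB : MeasurableSet B) (hD : MeasurableSet D),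
      inner ℂ (indicatorConstLp 2 (hB.prod hD) (measure_ne_top (κ.prod m) _) (1 : ℂ)) q = 0) :
    q = 0 := by
  have hint : Integrable q (κ.prod m) := (Lp.memLp q).integrable one_le_two
  have hset : ∀ E : Set (X × Y), MeasurableSet E → ∫ x in E, q x ∂(κ.prod m) = 0 := by
    intro E hE
    have huniv : ∫ x, q x ∂(κ.prod m) = 0 := by
      have := hq univ univ .univ .univ
      rw [L2.inner_indicatorConstLp_one] at this
      simpa using this
    induction E, hE using MeasurableSpace.induction_on_inter generateFrom_prod.symm
      isPiSystem_prod with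
    | empty => simp
    | basic E hE =>
      obtain ⟨B, hB, D, hD, rfl⟩ := hE
      have := hq B D hB hD
      rwa [L2.inner_indicatorConstLp_one] at this
    | compl E hE ih =>
      have := integral_add_compl hE hint
      rw [ih, huniv, zero_add] at this
      exact this
    | iUnion E hd hE ih =>
      rw [integral_iUnion hE hd hint.integrableOn]
      simp [ih]
  have := hint.ae_eq_zero_of_forall_setIntegral_eq_zero fun E hE _ => hset E hE
  exact Lp.ext (this.trans (Lp.coeFn_zero ℂ 2 (κ.prod m)).symm)

/-- The skew product over the identity of `Y` which moves the fibre over `y` during the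
time `u y`. -/
def skew (S : ℝ≥0 → X → X) (u : Y → ℝ≥0) (p : X × Y) : X × Y := (S (u p.2) p.1, p.2)

/-- A jointly measurable semi-flow which preserves the measure `κ`. -/
structure MeasurePreservingSemiflow (κ : Measure X) (S : ℝ≥0 → X → X) : Prop where
  measurable : Measurable fun q : ℝ≥0 × X => S q.1 q.2
  add : ∀ a b x, S (a + b) x = S a (S b x)
  measurePreserving : ∀ a, MeasurePreserving (S a) κ κ

variable {κ : Measure X} {m : Measure Y} {S : ℝ≥0 → X → X}

omit [MeasurableSpace Y] in
theorem MeasurePreservingSemiflow.skew_comp_skew (hS : MeasurePreservingSemiflow κ S)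
    (u v : Y → ℝ≥0) : skew S u ∘ skew S v = skew S (u + v) := by
  funext p
  simp [skew, hS.add]

theorem MeasurePreservingSemiflow.measurePreserving_skew [SFinite κ] [SFinite m]
    (hS : MeasurePreservingSemiflow κ S) {u : Y → ℝ≥0} (hu : Measurable u) :
    MeasurePreserving (skew S u) (κ.prod m) (κ.prod m) := by
  have h := (MeasurePreserving.id m).skew_product (g := fun y x => S (u y) x) (μc := κ) (μd := κ)
    (hS.measurable.comp ((hu.comp measurable_fst).prodMk measurable_snd))
    (.of_forall fun y => (hS.measurePreserving (u y)).map_eq)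
  exact (Measure.measurePreserving_swap.comp h).comp Measure.measurePreserving_swap

/-- Fubini over the unmoved base: correlations of rectangles depend on the dynamics only through the
fibre correlation τ ↦ κ(B' ∩ S_τ⁻¹ B), a scalar function bounded by 1. -/
theorem MeasurePreservingSemiflow.measureReal_inter_skew [IsProbabilityMeasure κ]
    [IsProbabilityMeasure m] (hS : MeasurePreservingSemiflow κ S) {u : Y → ℝ≥0}
    (hu : Measurable u) {B B' : Set X} (hB : MeasurableSet B) (hB' : MeasurableSet B')
    {D D' : Set Y} (hD : MeasurableSet D) (hD' : MeasurableSet D') :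
    (κ.prod m).real (B' ×ˢ D' ∩ skew S u ⁻¹' (B ×ˢ D))
      = ∫ y in D' ∩ D, κ.real (B' ∩ S (u y) ⁻¹' B) ∂m := by
  have hmeas : MeasurableSet (B' ×ˢ D' ∩ skew S u ⁻¹' (B ×ˢ D)) :=
    (hB'.prod hD').inter ((hS.measurePreserving_skew (m := m) hu).measurable (hB.prod hD))
  have hE : Measurable fun y => κ (B' ∩ S (u y) ⁻¹' B) := by
    have : MeasurableSet {q : Y × X | q.2 ∈ B' ∧ S (u q.1) q.2 ∈ B} :=
      (measurable_snd hB').inter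
        ((hS.measurable.comp ((hu.comp measurable_fst).prodMk measurable_snd)) hB)
    exact measurable_measure_prodMk_left this
  simp only [measureReal_def]
  rw [integral_toReal hE.aemeasurable (.of_forall fun _ => measure_lt_top _ _),
    Measure.prod_apply_symm hmeas, ← lintegral_indicator (hD'.inter hD)]
  congr 1
  refine lintegral_congr fun y => ?_
  by_cases hy : y ∈ D' ∩ D
  · rw [indicator_of_mem hy]
    congr 1
    ext x
    simp [skew, hy.1, hy.2]
  · rw [indicator_of_notMem hy]
    convert measure_empty (μ := κ)
    ext x
    simp only [skew, mem_preimage, mem_inter_iff, mem_prod, mem_empty_iff_false, iff_false]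
    exact fun h => hy ⟨h.1.2, h.2.2⟩

end Skew

/-! ### Koopman operators and the projection onto invariant functions. -/

section Koopman

variable {Ω : Type*} [MeasurableSpace Ω] {μ : Measure Ω}

theorem invariantSigmaAlgebra_le (g : ℝ≥0 → Ω → Ω) :
    invariantSigmaAlgebra g ≤ ‹MeasurableSpace Ω› :=
  (iInf_le _ 0).trans (MeasurableSpace.invariants_le _)

theorem measurableSet_invariantSigmaAlgebra {g : ℝ≥0 → Ω → Ω} {B : Set Ω} :
    MeasurableSet[invariantSigmaAlgebra g] B ↔ ∀ t, MeasurableSet B ∧ g t ⁻¹' B = B :=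
  MeasurableSpace.measurableSet_iInf

/-- The Koopman operator on `L²`. -/
noncomputable abbrev koopman (g : Ω → Ω) (hg : MeasurePreserving g μ μ) :
    Lp ℂ 2 μ →ₗᵢ[ℂ] Lp ℂ 2 μ :=
  Lp.compMeasurePreservingₗᵢ ℂ g hg

theorem coeFn_koopman {g : Ω → Ω} (hg : MeasurePreserving g μ μ) (f : Lp ℂ 2 μ) :
    koopman g hg f =ᵐ[μ] f ∘ g :=
  Lp.coeFn_compMeasurePreserving f hg

theorem koopman_indicatorConstLp [IsFiniteMeasure μ] {g : Ω → Ω} (hg : MeasurePreserving g μ μ)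
    {B : Set Ω} (hB : MeasurableSet B) :
    koopman g hg (indicatorConstLp 2 hB (measure_ne_top μ _) 1)
      = indicatorConstLp 2 (hg.measurable hB) (measure_ne_top μ _) 1 :=
  Lp.indicatorConstLp_compMeasurePreserving hB (measure_ne_top μ _) 1 hg

/-- The orthogonal projection of `L²` onto the functions which are measurable with respect to
the invariant σ-algebra. -/
noncomputable def invariantProjection (μ : Measure Ω) (g : ℝ≥0 → Ω → Ω) :
    Lp ℂ 2 μ →L[ℂ] Lp ℂ 2 μ :=
  (lpMeas ℂ ℂ (invariantSigmaAlgebra g) 2 μ).subtypeL ∘L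
    condExpL2 ℂ ℂ (invariantSigmaAlgebra_le g)

theorem inner_invariantProjection_left (g : ℝ≥0 → Ω → Ω) (f h : Lp ℂ 2 μ) :
    inner ℂ (invariantProjection μ g f) h = inner ℂ f (invariantProjection μ g h) :=
  inner_condExpL2_left_eq_right (invariantSigmaAlgebra_le g)

theorem norm_invariantProjection_le (g : ℝ≥0 → Ω → Ω) (f : Lp ℂ 2 μ) :
    ‖invariantProjection μ g f‖ ≤ ‖f‖ :=
  norm_condExpL2_le (invariantSigmaAlgebra_le g) f

theorem invariantProjection_idem (g : ℝ≥0 → Ω → Ω) (f : Lp ℂ 2 μ) :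
    invariantProjection μ g (invariantProjection μ g f) = invariantProjection μ g f := by
  have : Fact (invariantSigmaAlgebra g ≤ ‹MeasurableSpace Ω›) := ⟨invariantSigmaAlgebra_le g⟩
  exact congrArg Subtype.val (Submodule.orthogonalProjectionOnto_mem_subspace_eq_self
    (condExpL2 ℂ ℂ (invariantSigmaAlgebra_le g) f))

/-- A representative measurable for the invariant σ-algebra is strictly invariant, and `g t` pulls
null sets back to null sets. -/
theorem koopman_invariantProjection {g : ℝ≥0 → Ω → Ω} {t : ℝ≥0}
    (hg : MeasurePreserving (g t) μ μ) (f : Lp ℂ 2 μ) :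
    koopman (g t) hg (invariantProjection μ g f) = invariantProjection μ g f := by
  obtain ⟨k, hk, hfk⟩ := mem_lpMeas_iff_aestronglyMeasurable.1
    (condExpL2 ℂ ℂ (invariantSigmaAlgebra_le g) f).2
  have hfk : (invariantProjection μ g f : Ω → ℂ) =ᵐ[μ] k := hfk
  have hinv : k ∘ g t = k := MeasurableSpace.comp_eq_of_measurable_invariants
    (hk.measurable.mono (iInf_le _ t) le_rfl)
  refine Lp.ext ?_
  filter_upwards [coeFn_koopman hg (invariantProjection μ g f), hfk,
    hg.quasiMeasurePreserving.ae hfk] with x h1 h2 h3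
  rw [h1, h2, Function.comp_apply, h3]
  exact congrFun hinv x

/-- A function in the range of the projection is unaffected, so a function whose Koopman orbit
tends weakly to zero has vanishing projection. -/
theorem invariantProjection_eq_zero {g : ℝ≥0 → Ω → Ω} (hg : ∀ t, MeasurePreserving (g t) μ μ)
    {f : Lp ℂ 2 μ}
    (hf : ∀ h, Tendsto (fun t => inner ℂ h (koopman (g t) (hg t) f)) atTop (𝓝 0)) :
    invariantProjection μ g f = 0 := by
  refine ext_inner_left ℂ fun h => ?_
  rw [inner_zero_right, ← inner_invariantProjection_left]
  refine tendsto_nhds_unique (tendsto_const_nhds.congr fun t => ?_)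
    (hf (invariantProjection μ g h))
  -- ⟨Ph, f⟩ = ⟨V_t Ph, V_t f⟩ = ⟨Ph, V_t f⟩ for the Koopman operator V_t of `g t`: a constant that
  -- tends to 0.
  rw [← (koopman (g t) (hg t)).inner_map_map, koopman_invariantProjection]

end Koopman

/-! ### Keplerian shear from an absolutely continuous law of speeds. -/

section Shear

variable {X Y : Type*} [MeasurableSpace X] [MeasurableSpace Y]
  {κ : Measure X} {m : Measure Y} {S : ℝ≥0 → X → X}

theorem MeasurePreservingSemiflow.inner_indicator_koopman_skew [IsProbabilityMeasure κ]
    [IsProbabilityMeasure m] (hS : MeasurePreservingSemiflow κ S) {u : Y → ℝ≥0}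
    (hu : Measurable u) {B B' : Set X} (hB : MeasurableSet B) (hB' : MeasurableSet B')
    {D D' : Set Y} (hD : MeasurableSet D) (hD' : MeasurableSet D') :
    inner ℂ (indicatorConstLp 2 (hB'.prod hD') (measure_ne_top (κ.prod m) _) (1 : ℂ))
      (koopman (skew S u) (hS.measurePreserving_skew hu)
        (indicatorConstLp 2 (hB.prod hD) (measure_ne_top (κ.prod m) _) 1))
      = ((∫ y in D' ∩ D, κ.real (B' ∩ S (u y) ⁻¹' B) ∂m : ℝ) : ℂ) := by
  rw [koopman_indicatorConstLp, L2.inner_indicatorConstLp_indicatorConstLp,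
    hS.measureReal_inter_skew hu hB hB' hD hD']
  simp

theorem MeasurePreservingSemiflow.koopman_koopman [SFinite κ] [SFinite m]
    (hS : MeasurePreservingSemiflow κ S) {u v : Y → ℝ≥0} (hu : Measurable u) (hv : Measurable v)
    (f : Lp ℂ 2 (κ.prod m)) :
    koopman (skew S u) (hS.measurePreserving_skew hu)
        (koopman (skew S v) (hS.measurePreserving_skew hv) f)
      = koopman (skew S (v + u)) (hS.measurePreserving_skew (hv.add hu)) f := by
  refine Lp.ext ?_
  filter_upwards [coeFn_koopman (hS.measurePreserving_skew hu)
      (koopman (skew S v) (hS.measurePreserving_skew hv) f),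
    (hS.measurePreserving_skew hu).quasiMeasurePreserving.ae
      (coeFn_koopman (hS.measurePreserving_skew hv) f),
    coeFn_koopman (hS.measurePreserving_skew (hv.add hu)) f] with x h1 h2 h3
  rw [h1, h3, ← hS.skew_comp_skew, Function.comp_apply, h2]
  rfl

/-- Coboundaries of the fibre flow tend weakly to zero along the stretched flow. -/
theorem MeasurePreservingSemiflow.tendsto_inner_koopman_coboundary [IsProbabilityMeasure κ]
    [IsProbabilityMeasure m] (hS : MeasurePreservingSemiflow κ S) {w : Y → ℝ≥0}
    (hw : Measurable w) (hac : m.map (fun y => (w y : ℝ)) ≪ volume) (s : ℝ≥0)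
    {B : Set X} (hB : MeasurableSet B) {D : Set Y} (hD : MeasurableSet D)
    (h : Lp ℂ 2 (κ.prod m)) :
    Tendsto (fun t : ℝ≥0 => inner ℂ h
      (koopman (skew S fun y => w y * t) (hS.measurePreserving_skew (hw.mul_const t))
        (koopman (skew S fun _ => s) (hS.measurePreserving_skew measurable_const)
            (indicatorConstLp 2 (hB.prod hD) (measure_ne_top (κ.prod m) _) 1)
          - indicatorConstLp 2 (hB.prod hD) (measure_ne_top (κ.prod m) _) 1)))
      atTop (𝓝 0) := by
  set e : Lp ℂ 2 (κ.prod m) :=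
    indicatorConstLp 2 (hB.prod hD) (measure_ne_top (κ.prod m) _) 1 with he
  set f := koopman (skew S fun _ : Y => s) (hS.measurePreserving_skew measurable_const) e - e
  refine tendsto_zero_of_total (E := Lp ℂ 2 (κ.prod m)) (fun (t : ℝ≥0) h => inner ℂ h
    (koopman (skew S fun y => w y * t) (hS.measurePreserving_skew (hw.mul_const t)) f)) ‖f‖
    (fun t x y => inner_add_left _ _ _) (fun t a x => by rw [inner_smul_left]; simp)
    (fun t x => ?_)
    {h | ∃ (B' : Set X) (D' : Set Y) (hB' : MeasurableSet B') (hD' : MeasurableSet D'),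
      h = indicatorConstLp 2 (hB'.prod hD') (measure_ne_top (κ.prod m) _) 1}
    (fun q hq => eq_zero_of_inner_indicator_prod_eq_zero q
      fun B' D' hB' hD' => hq _ ⟨B', D', hB', hD', rfl⟩) ?_ h
  · refine (norm_inner_le_norm _ _).trans ?_
    rw [LinearIsometry.norm_map, mul_comm]
  rintro _ ⟨B', D', hB', hD', rfl⟩
  -- The fibre correlation; its values at negative times play no role, as speeds and times are
  -- nonnegative.
  set C : ℝ → ℝ := fun τ => κ.real (B' ∩ S τ.toNNReal ⁻¹' B) with hC
  have hCm : Measurable C := by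
    have : MeasurableSet {q : ℝ × X | q.2 ∈ B' ∧ S q.1.toNNReal q.2 ∈ B} :=
      (measurable_snd hB').inter ((hS.measurable.comp
        ((measurable_real_toNNReal.comp measurable_fst).prodMk measurable_snd)) hB)
    exact (measurable_measure_prodMk_left this).ennreal_toReal
  have hC1 : ∀ x, ‖C x‖ ≤ 1 := fun x => by
    rw [Real.norm_of_nonneg measureReal_nonneg]
    exact measureReal_le_one
  have hwm : Measurable fun y => (w y : ℝ) := measurable_coe_nnreal_real.comp hw
  have hac' : (m.restrict (D' ∩ D)).map (fun y => (w y : ℝ)) ≪ volume :=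
    (Measure.AbsolutelyContinuous.map Measure.absolutelyContinuous_restrict hwm).trans hac
  have hlim := (tendsto_integral_dilation_shift_sub hac' hCm hC1 s).comp
    (NNReal.tendsto_coe_atTop.2 tendsto_id)
  have hlim' := (Complex.continuous_ofReal.tendsto 0).comp hlim
  rw [Complex.ofReal_zero] at hlim'
  refine hlim'.congr fun t => ?_
  have hint : ∀ ψ : Y → ℝ, Measurable ψ → Integrable (fun y => C (ψ y)) (m.restrict (D' ∩ D)) :=
    fun ψ hψ => Integrable.of_bound (hCm.comp hψ).aestronglyMeasurable 1
      (.of_forall fun y => hC1 _)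
  have h1 := hS.inner_indicator_koopman_skew (m := m) (hw.mul_const t) hB hB' hD hD'
  have h2 := hS.inner_indicator_koopman_skew (m := m)
    ((measurable_const (a := s)).add (hw.mul_const t)) hB hB' hD hD'
  simp only [f]
  rw [map_sub, inner_sub_right, h1, hS.koopman_koopman (hw.mul_const t) measurable_const]
  refine Eq.trans ?_ (congrArg₂ (· - ·) h2.symm rfl)
  have hsum : ∀ y, C ((w y : ℝ) * t + s) = κ.real (B' ∩ S (s + w y * t) ⁻¹' B) := fun y => by
    rw [hC, show (w y : ℝ) * t + s = ((s + w y * t : ℝ≥0) : ℝ) by push_cast; ring]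
    simp only [Real.toNNReal_coe]
  have hmul : ∀ y, C ((w y : ℝ) * t) = κ.real (B' ∩ S (w y * t) ⁻¹' B) := fun y => by
    rw [hC, show (w y : ℝ) * t = ((w y * t : ℝ≥0) : ℝ) by push_cast; ring]
    simp only [Real.toNNReal_coe]
  simp only [Function.comp_apply, id_eq]
  rw [integral_map hwm.aemeasurable (Measurable.aestronglyMeasurable (by fun_prop)),
    integral_sub (hint _ (by fun_prop)) (hint _ (by fun_prop)), Complex.ofReal_sub]
  simp only [hsum, hmul]
  rfl

/-- A set which is almost invariant under each time of a semi-flow acting on the first factor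
coincides almost everywhere with a strictly invariant one. -/
theorem MeasurePreservingSemiflow.exists_invariant_ae_eq [IsProbabilityMeasure κ]
    [IsProbabilityMeasure m] (hS : MeasurePreservingSemiflow κ S) {B : Set (X × Y)}
    (hB : MeasurableSet B)
    (hinv : ∀ s : ℝ≥0, skew S (fun _ : Y => s) ⁻¹' B =ᵐ[κ.prod m] B) :
    ∃ B' : Set (X × Y), MeasurableSet B' ∧ B' =ᵐ[κ.prod m] B ∧
      ∀ u : Y → ℝ≥0, skew S u ⁻¹' B' = B' := by
  let G : ℝ → X × Y → X × Y := fun s => skew S fun _ => s.toNNReal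
  have hG : Measurable fun q : (X × Y) × ℝ => G q.2 q.1 :=
    (hS.measurable.comp ((measurable_real_toNNReal.comp measurable_snd).prodMk
      (measurable_fst.comp measurable_fst))).prodMk (measurable_snd.comp measurable_fst)
  let R : ℕ → Set ((X × Y) × ℝ) := fun N => {q | (N : ℝ) ≤ q.2 ∧ G q.2 q.1 ∉ B}
  have hR : ∀ N, MeasurableSet (R N) := fun N =>
    (measurableSet_le measurable_const measurable_snd).inter (hG hB.compl)
  -- Points whose fibre orbit is in `B` at almost every sufficiently late time. Requiring this only
  -- for late times makes the condition insensitive to a delay `u p.2`, so invariance is an equality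
  -- and not just an inclusion, although the flow only goes forward.
  let B' : Set (X × Y) := ⋃ N : ℕ, {p | volume (Prod.mk p ⁻¹' R N) = 0}
  have hB' : ∀ p, p ∈ B' ↔ ∃ N : ℕ, ∀ᵐ s : ℝ, (N : ℝ) ≤ s → G s p ∈ B := by
    intro p
    simp only [B', mem_iUnion]
    refine exists_congr fun N => ?_
    change volume {s : ℝ | (N : ℝ) ≤ s ∧ G s p ∉ B} = 0 ↔ _
    rw [ae_iff]
    simp only [Classical.not_imp]
  refine ⟨B', MeasurableSet.iUnion fun N =>
    measurable_measure_prodMk_left (hR N) (measurableSet_singleton 0), ?_, fun u => ?_⟩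
  · have hmeas : MeasurableSet {q : (X × Y) × ℝ | G q.2 q.1 ∈ B ↔ q.1 ∈ B} :=
      (hG hB).iff (measurable_fst hB)
    -- Fubini turns "for each s, a.e. p" into "for a.e. p, a.e. s".
    have hae : ∀ᵐ p ∂(κ.prod m), ∀ᵐ s : ℝ, (G s p ∈ B ↔ p ∈ B) := by
      rw [Measure.ae_ae_comm hmeas]
      exact .of_forall fun s => (hinv s.toNNReal).mem_iff
    filter_upwards [hae] with p hp
    refine propext ((hB' p).trans ⟨?_, fun h => ⟨0, ?_⟩⟩)
    · rintro ⟨N, hN⟩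
      have : ∃ᵐ s : ℝ, (N : ℝ) ≤ s := by
        rw [frequently_ae_iff]
        simp [show {s : ℝ | (N : ℝ) ≤ s} = Ici (N : ℝ) from rfl]
      obtain ⟨s, hs, hsN, hsp⟩ := (this.and_eventually (hN.and hp)).exists
      exact hsp.1 (hsN hs)
    · filter_upwards [hp] with s hs _
      exact hs.2 h
  · ext p
    rw [mem_preimage, hB', hB']
    have hG' : ∀ s : ℝ, 0 ≤ s → G s (skew S u p) = G (s + u p.2) p := fun s hs => by
      simp only [G, skew, ← hS.add]
      rw [Real.toNNReal_add hs (u p.2).coe_nonneg, Real.toNNReal_coe]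
    constructor
    · rintro ⟨N, hN⟩
      obtain ⟨N', hN'⟩ := exists_nat_ge ((N : ℝ) + u p.2)
      refine ⟨N', ?_⟩
      have := (measurePreserving_sub_right (volume : Measure ℝ)
        (u p.2 : ℝ)).quasiMeasurePreserving.ae hN
      filter_upwards [this] with s hs hNs
      have h1 : (N : ℝ) ≤ s - u p.2 := by linarith
      have h2 := hs h1
      rwa [hG' _ (N.cast_nonneg.trans h1), sub_add_cancel] at h2
    · rintro ⟨N, hN⟩
      refine ⟨N, ?_⟩
      have := (measurePreserving_add_right (volume : Measure ℝ)
        (u p.2 : ℝ)).quasiMeasurePreserving.ae hN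
      filter_upwards [this] with s hs hNs
      rw [hG' _ (N.cast_nonneg.trans hNs)]
      exact hs (hNs.trans (le_add_of_nonneg_right (u p.2).coe_nonneg))

/-- A vector of `L²` which is fixed by the fibre flow and has vanishing projection on the
invariant functions of the stretched flow is zero. -/
theorem MeasurePreservingSemiflow.eq_zero_of_koopman_fixed [IsProbabilityMeasure κ]
    [IsProbabilityMeasure m] (hS : MeasurePreservingSemiflow κ S) {w : Y → ℝ≥0}
    (q : Lp ℂ 2 (κ.prod m))
    (hq : ∀ s : ℝ≥0,
      koopman (skew S fun _ : Y => s) (hS.measurePreserving_skew measurable_const) q = q)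
    (hPq : invariantProjection (κ.prod m) (fun t => skew S fun y => w y * t) q = 0) :
    q = 0 := by
  have hint : Integrable q (κ.prod m) := (Lp.memLp q).integrable one_le_two
  -- The choices c = ±1, ±i annihilate the real and imaginary parts of `q`.
  have key : ∀ c : ℂ, ∀ᵐ p ∂(κ.prod m), (c * q p).re ≤ 0 := by
    intro c
    set F : X × Y → ℝ := fun p => (c * q p).re
    have hF : Measurable F :=
      Complex.measurable_re.comp (measurable_const.mul (Lp.stronglyMeasurable q).measurable)
    have hFint : Integrable F (κ.prod m) := (hint.const_mul c).re
    set B : Set (X × Y) := {p | 0 < F p}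
    have hB : MeasurableSet B := measurableSet_lt measurable_const hF
    obtain ⟨B', hB'm, hB', hinv⟩ := hS.exists_invariant_ae_eq (m := m) hB fun s => by
      have h := coeFn_koopman (hS.measurePreserving_skew (m := m) (measurable_const (a := s))) q
      rw [hq s] at h
      filter_upwards [h] with p hp
      refine propext ?_
      change 0 < (c * q (skew S (fun _ => s) p)).re ↔ 0 < (c * q p).re
      rw [hp, Function.comp_apply]
    have hB'I : MeasurableSet[invariantSigmaAlgebra fun t => skew S fun y => w y * t] B' :=
      measurableSet_invariantSigmaAlgebra.2 fun t => ⟨hB'm, hinv _⟩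
    -- ∫_{B'} q = ⟨1_{B'}, q⟩ = ⟨P 1_{B'}, q⟩ = ⟨1_{B'}, Pq⟩ = 0. As `F` is positive on `B`, which
    -- equals `B'` a.e., `B` must be null.
    have h0 : ∫ p in B', q p ∂(κ.prod m) = 0 := by
      rw [← L2.inner_indicatorConstLp_one (𝕜 := ℂ) hB'm (measure_ne_top (κ.prod m) _)]
      have h1 : invariantProjection (κ.prod m) (fun t => skew S fun y => w y * t)
          (indicatorConstLp 2 hB'm (measure_ne_top (κ.prod m) _) 1)
          = indicatorConstLp 2 hB'm (measure_ne_top (κ.prod m) _) 1 :=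
        condExpL2_indicator_of_measurable (invariantSigmaAlgebra_le _) hB'I
          (measure_ne_top (κ.prod m) _) 1
      rw [← h1, inner_invariantProjection_left, hPq, inner_zero_right]
    have h2 : ∫ p in B, F p ∂(κ.prod m) = 0 := by
      rw [← setIntegral_congr_set hB']
      change ∫ p in B', RCLike.re (c * q p) ∂(κ.prod m) = 0
      rw [integral_re (hint.const_mul c).integrableOn, integral_const_mul, h0]
      simp
    have h3 := (setIntegral_eq_zero_iff_of_nonneg_ae
      ((ae_restrict_iff' hB).2 (.of_forall fun p hp => le_of_lt hp)) hFint.integrableOn).1 h2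
    filter_upwards [(ae_restrict_iff' hB).1 h3] with p hp
    by_contra hlt
    have hpB : p ∈ B := not_le.1 hlt
    exact (not_le.1 hlt).ne' (hp hpB)
  refine Lp.ext ?_
  filter_upwards [key 1, key (-1), key Complex.I, key (-Complex.I),
    Lp.coeFn_zero ℂ 2 (κ.prod m)] with p h1 h2 h3 h4 h5
  rw [h5]
  simp only [one_mul, neg_mul, Complex.neg_re, Complex.mul_re, Complex.I_re, Complex.I_im,
    zero_mul, zero_sub, neg_neg, Left.neg_nonpos_iff] at h1 h2 h3 h4
  exact Complex.ext (le_antisymm h1 h2) (le_antisymm h4 h3)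

/-- Expand ‖Vq - q‖². This upgrades V* q = q to Vq = q without invertibility of V, as `T` need not
be invertible. -/
theorem LinearIsometry.map_eq_self_of_inner_map_eq {E : Type*} [NormedAddCommGroup E]
    [InnerProductSpace ℂ E] (V : E →ₗᵢ[ℂ] E) {q : E} (h : inner ℂ (V q) q = inner ℂ q q) :
    V q = q := by
  have h1 := norm_sub_sq (𝕜 := ℂ) (V q) q
  rw [h, V.norm_map, inner_self_eq_norm_sq] at h1
  have h2 : ‖V q - q‖ ^ 2 = 0 := by rw [h1]; ring
  exact sub_eq_zero.1 (norm_eq_zero.1 (pow_eq_zero_iff two_ne_zero |>.1 h2))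

/-- **Keplerian shear** for a measure preserving semi-flow stretched by speeds whose law is
absolutely continuous. -/
theorem MeasurePreservingSemiflow.keplerianShear [IsProbabilityMeasure κ]
    [IsProbabilityMeasure m] (hS : MeasurePreservingSemiflow κ S) {w : Y → ℝ≥0}
    (hw : Measurable w) (hac : m.map (fun y => (w y : ℝ)) ≪ volume) :
    KeplerianShear (κ.prod m) fun t : ℝ≥0 => skew S fun y => w y * t := by
  set μ := κ.prod m
  set g : ℝ≥0 → X × Y → X × Y := fun t => skew S fun y => w y * t
  have hg : ∀ t, MeasurePreserving (g t) μ μ := fun t =>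
    hS.measurePreserving_skew (hw.mul_const t)
  let P := invariantProjection μ g
  have hV : ∀ s : ℝ≥0, MeasurePreserving (skew S fun _ : Y => s) μ μ := fun s =>
    hS.measurePreserving_skew measurable_const
  let c : ∀ (s : ℝ≥0) (B : Set X) (D : Set Y), MeasurableSet B → MeasurableSet D → Lp ℂ 2 μ :=
    fun s B D hB hD => koopman _ (hV s) (indicatorConstLp 2 (hB.prod hD) (measure_ne_top μ _) 1)
      - indicatorConstLp 2 (hB.prod hD) (measure_ne_top μ _) 1
  have hc : ∀ s B D hB hD h,
      Tendsto (fun t => inner ℂ h (koopman (g t) (hg t) (c s B D hB hD))) atTop (𝓝 0) :=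
    fun s B D hB hD h => hS.tendsto_inner_koopman_coboundary hw hac s hB hD h
  have main : ∀ h f : Lp ℂ 2 μ,
      Tendsto (fun t => inner ℂ h (koopman (g t) (hg t) f - P f)) atTop (𝓝 0) := by
    intro h
    refine tendsto_zero_of_total (fun t f => inner ℂ h (koopman (g t) (hg t) f - P f)) (‖h‖ * 2)
      (fun t x y => by rw [map_add, map_add, add_sub_add_comm, inner_add_right])
      (fun t a x => by rw [map_smul, map_smul, ← smul_sub, inner_smul_right, norm_mul])
      (fun t x => ?_) (range P ∪ {f | ∃ s B D hB hD, f = c s B D hB hD}) (fun q hq => ?_) ?_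
    · refine (norm_inner_le_norm _ _).trans ?_
      rw [mul_assoc]
      refine mul_le_mul_of_nonneg_left ((norm_sub_le _ _).trans ?_) (norm_nonneg _)
      rw [LinearIsometry.norm_map, two_mul]
      exact add_le_add_right (norm_invariantProjection_le g x) _
    · have hPq : P q = 0 := by
        refine ext_inner_left ℂ fun f => ?_
        rw [inner_zero_right, ← inner_invariantProjection_left]
        exact hq _ (.inl ⟨f, rfl⟩)
      refine hS.eq_zero_of_koopman_fixed q (fun s => ?_) hPq
      refine LinearIsometry.map_eq_self_of_inner_map_eq _ ?_
      -- Orthogonality to V_s e - e reads ⟨e, V_s* q - q⟩ = 0, and the rectangle indicators e are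
      -- total.
      have hadj : (koopman _ (hV s)).toContinuousLinearMap.adjoint q - q = 0 := by
        refine eq_zero_of_inner_indicator_prod_eq_zero _ fun B D hB hD => ?_
        rw [inner_sub_right, ContinuousLinearMap.adjoint_inner_right, ← inner_sub_left]
        exact hq _ (.inr ⟨s, B, D, hB, hD, rfl⟩)
      have h1 := ContinuousLinearMap.adjoint_inner_right
        (koopman _ (hV s)).toContinuousLinearMap q q
      rw [sub_eq_zero.1 hadj] at h1
      exact h1.symm
    · rintro _ (⟨f, rfl⟩ | ⟨s, B, D, hB, hD, rfl⟩)
      · have hPP : P (P f) = P f := invariantProjection_idem g f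
        have : ∀ t, inner ℂ h (koopman (g t) (hg t) (P f) - P (P f)) = 0 := fun t => by
          rw [hPP, koopman_invariantProjection, sub_self, inner_zero_right]
        simp [this]
      · have hPc : P (c s B D hB hD) = 0 := invariantProjection_eq_zero hg (hc s B D hB hD)
        simpa [hPc] using hc s B D hB hD h
  refine ⟨inferInstance, hg, fun f h hf hh => ?_⟩
  have h1 := (main (hh.toLp h) (hf.toLp f)).add
    (tendsto_const_nhds (x := inner ℂ (hh.toLp h) (P (hf.toLp f))))
  rw [zero_add] at h1
  have hPf : (P (hf.toLp f) : X × Y → ℂ) =ᵐ[μ] μ[f | invariantSigmaAlgebra g] :=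
    hf.condExpL2_ae_eq_condExp (𝕜 := ℂ) (invariantSigmaAlgebra_le g)
  have hlim : inner ℂ (hh.toLp h) (P (hf.toLp f))
      = ∫ x, conj (h x) * (μ[f | invariantSigmaAlgebra g]) x ∂μ := by
    rw [L2.inner_def]
    refine integral_congr_ae ?_
    filter_upwards [hPf, hh.coeFn_toLp] with x h2 h3
    rw [h2, h3, RCLike.inner_apply, mul_comm]
  rw [hlim] at h1
  refine h1.congr fun t => ?_
  rw [← hlim, ← inner_add_right, sub_add_cancel, L2.inner_def]
  refine integral_congr_ae ?_
  filter_upwards [coeFn_koopman (hg t) (hf.toLp f), hh.coeFn_toLp,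
    (hg t).quasiMeasurePreserving.ae hf.coeFn_toLp] with x h2 h3 h4
  rw [h2, h3, Function.comp_apply, h4, RCLike.inner_apply, mul_comm]

end Shear

/-! ### Null sets and submersions to the line. -/

section Submersion

/-- At points where the differential of a `C¹` function does not vanish, preimages of null sets
are null. -/
theorem volume_preimage_inter_fderiv_ne_zero {E : Type*} [NormedAddCommGroup E]
    [NormedSpace ℝ E] [FiniteDimensional ℝ E] [MeasurableSpace E] [BorelSpace E] (μ : Measure E)
    [μ.IsAddHaarMeasure] {u : E → ℝ} {U : Set E} (hU : IsOpen U) (hu : ContDiffOn ℝ 1 u U)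
    {N : Set ℝ} (hN : volume N = 0) :
    μ {z | z ∈ U ∧ u z ∈ N ∧ fderiv ℝ u z ≠ 0} = 0 := by
  refine measure_null_of_locally_null _ fun x hx => ?_
  obtain ⟨hxU, -, hL0⟩ := hx
  set L := fderiv ℝ u x
  obtain ⟨b, hb⟩ : ∃ b, L b = 1 :=
    LinearMap.surjective (f := (L : E →ₗ[ℝ] ℝ)) (fun h => hL0 (by ext z; simpa using DFunLike.congr_fun h z)) 1
  -- Straightening map: `L ∘ Φ = u`, and the differential of `Φ` at `x` is the identity. Near `x`,
  -- the preimage of `N` under `u` lies in the image of the null set `L ⁻¹' N` by the differentiable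
  -- local inverse of `Φ`.
  let Φ : E → E := fun z => z + (u z - L z) • b
  have hux : ContDiffAt ℝ 1 u x := hu.contDiffAt (hU.mem_nhds hxU)
  have hΦ : ContDiffAt ℝ 1 Φ x :=
    contDiffAt_id.add ((hux.sub L.contDiff.contDiffAt).smul contDiffAt_const)
  have hΦ' : HasFDerivAt Φ ((ContinuousLinearEquiv.refl ℝ E : E ≃L[ℝ] E) : E →L[ℝ] E) x := by
    have h1 := (hux.differentiableAt one_ne_zero).hasFDerivAt
    have h2 := (hasFDerivAt_id (𝕜 := ℝ) x).add ((h1.sub L.hasFDerivAt).smul_const b)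
    have h3 : ((ContinuousLinearEquiv.refl ℝ E : E ≃L[ℝ] E) : E →L[ℝ] E)
        = ContinuousLinearMap.id ℝ E + (fderiv ℝ u x - L).smulRight b := by
      ext z
      simp [L]
    rw [h3]
    exact h2
  have hLΦ : ∀ z, L (Φ z) = u z := fun z => by simp [Φ, hb]
  have hNL : μ (L ⁻¹' N) = 0 := by
    obtain ⟨N', hNN', hN'm, hN'⟩ := exists_measurable_superset_of_null hN
    have h := (ae_comp_linearMap_mem_iff (L : E →ₗ[ℝ] ℝ) μ volume
      (fun y => ⟨y • b, by simp [hb]⟩) hN'm.compl).2 (measure_eq_zero_iff_ae_notMem.1 hN')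
    exact measure_mono_null (preimage_mono hNN') (measure_eq_zero_iff_ae_notMem.2 h)
  have hinv := hΦ.to_localInverse hΦ' one_ne_zero
  set Ψ := hΦ.localInverse hΦ' one_ne_zero
  have hleft : ∀ᶠ z in 𝓝 x, Ψ (Φ z) = z :=
    (hΦ.hasStrictFDerivAt' hΦ' one_ne_zero).eventually_left_inverse
  have hdiff : ∀ᶠ y in 𝓝 (Φ x), DifferentiableAt ℝ Ψ y :=
    (hinv.eventually (by simp)).mono fun y hy => hy.differentiableAt one_ne_zero
  refine ⟨_, inter_mem_nhdsWithin _ (hleft.and (hΦ.continuousAt.eventually hdiff)), ?_⟩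
  refine measure_mono_null ?_ (addHaar_image_eq_zero_of_differentiableOn_of_addHaar_eq_zero μ
    (s := {y | DifferentiableAt ℝ Ψ y} ∩ L ⁻¹' N) (f := Ψ)
    (fun y hy => hy.1.differentiableWithinAt) (measure_mono_null inter_subset_right hNL))
  rintro z ⟨⟨-, hzN, -⟩, hz, hz'⟩
  exact ⟨Φ z, ⟨hz', by simpa [hLΦ] using hzN⟩, hz⟩

end Submersion

/-! ### Null sets and critical sets read in charts. -/

section Charts

variable {n : ℕ} {r : ℕ∞} {M : Type*} [TopologicalSpace M]
  [ChartedSpace (EuclideanSpace ℝ (Fin n)) M]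

local notation "𝔼" => EuclideanSpace ℝ (Fin n)

/-- To be Lebesgue null may be tested in countably many charts at points whose (possibly shrunk)
domains cover the manifold. -/
theorem lebesgueNull_of_countable_cover (hr : 1 ≤ r) [IsManifold (𝓡 n) r M] {S : Set M}
    {J : Set M} (hJ : J.Countable) {O : M → Set M} (hO : ⋃ x ∈ J, O x = univ)
    (hOs : ∀ x, O x ⊆ (chartAt 𝔼 x).source)
    (hS : ∀ x ∈ J, volume (chartAt 𝔼 x '' (S ∩ O x)) = 0) : LebesgueNull n S := by
  intro e he
  have hsub : e '' (S ∩ e.source) ⊆ ⋃ x ∈ J,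
      (e ∘ (chartAt 𝔼 x).symm) '' (chartAt 𝔼 x '' (S ∩ O x ∩ e.source)) := by
    rintro _ ⟨y, ⟨hyS, hye⟩, rfl⟩
    obtain ⟨x, hx, hyx⟩ := mem_iUnion₂.1 (hO.symm ▸ mem_univ y)
    refine mem_iUnion₂.2 ⟨x, hx, _, ⟨y, ⟨⟨hyS, hyx⟩, hye⟩, rfl⟩, ?_⟩
    simp [(chartAt 𝔼 x).left_inv (hOs x hyx)]
  refine measure_mono_null hsub ((measure_biUnion_null_iff hJ).2 fun x hx => ?_)
  refine addHaar_image_eq_zero_of_differentiableOn_of_addHaar_eq_zero volume ?_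
    (measure_mono_null (image_mono inter_subset_left) (hS x hx))
  have h1 : ContMDiffOn (𝓡 n) (𝓡 n) r e e.source :=
    contMDiffOn_of_mem_maximalAtlas (IsManifold.subset_maximalAtlas he)
  have h2 : ContMDiffOn (𝓡 n) (𝓡 n) r (chartAt 𝔼 x).symm (chartAt 𝔼 x).target :=
    contMDiffOn_symm_of_mem_maximalAtlas (IsManifold.chart_mem_maximalAtlas x)
  have h3 := contMDiffOn_iff_contDiffOn.1 (h1.comp' h2)
  refine (h3.differentiableOn ?_).mono ?_
  · have : (r : WithTop ℕ∞) ≠ 0 := by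
      rw [Ne, WithTop.coe_eq_zero]
      exact (zero_lt_one.trans_le hr).ne'
    exact this
  · rintro _ ⟨y, ⟨⟨-, hyx⟩, hye⟩, rfl⟩
    refine ⟨(chartAt 𝔼 x).map_source (hOs x hyx), ?_⟩
    rwa [mem_preimage, (chartAt 𝔼 x).left_inv (hOs x hyx)]

theorem contDiffOn_comp_chart_symm [IsManifold (𝓡 n) r M] (f : C^r⟮𝓡 n, M; ℝ⟯)
    {e : OpenPartialHomeomorph M 𝔼} (he : e ∈ atlas 𝔼 M) :
    ContDiffOn ℝ r (fun z => f (e.symm z)) e.target :=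
  contMDiffOn_iff_contDiffOn.1 (f.contMDiff.comp_contMDiffOn
    (contMDiffOn_symm_of_mem_maximalAtlas (n := (r : WithTop ℕ∞))
      (IsManifold.subset_maximalAtlas he)))

theorem continuousOn_iteratedFDeriv_chart [IsManifold (𝓡 n) r M] (f : C^r⟮𝓡 n, M; ℝ⟯)
    {e : OpenPartialHomeomorph M 𝔼} (he : e ∈ atlas 𝔼 M) {k : ℕ} (hk : (k : ℕ∞) ≤ r) :
    ContinuousOn (iteratedFDeriv ℝ k fun z => f (e.symm z)) e.target :=
  ((contDiffOn_comp_chart_symm f he).continuousOn_iteratedFDerivWithin (mod_cast hk)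
    e.open_target.uniqueDiffOn).congr (iteratedFDerivWithin_of_isOpen k e.open_target).symm

/-- The critical points of `f`, in a chart and inside `K`. -/
def criticalSet (e : OpenPartialHomeomorph M 𝔼) (K : Set 𝔼) (f : M → ℝ) : Set 𝔼 :=
  {z | z ∈ K ∧ ‖iteratedFDeriv ℝ 1 (fun z => f (e.symm z)) z‖ ≤ 0}

/-- The case δ = 0 is `criticalSet`; positive δ gives the larger sets used to show openness. -/
theorem measurableSet_norm_iteratedFDeriv_le (hr : 1 ≤ r) [IsManifold (𝓡 n) r M]
    (f : C^r⟮𝓡 n, M; ℝ⟯) {e : OpenPartialHomeomorph M 𝔼} (he : e ∈ atlas 𝔼 M) {K : Set 𝔼}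
    (hK : IsCompact K) (hKe : K ⊆ e.target) (δ : ℝ) :
    MeasurableSet {z | z ∈ K ∧ ‖iteratedFDeriv ℝ 1 (fun z => f (e.symm z)) z‖ ≤ δ} :=
  (((continuousOn_iteratedFDeriv_chart f he hr).mono hKe).norm.preimage_isClosed_of_isClosed
    hK.isClosed isClosed_Iic).measurableSet

theorem continuous_roofFunction_iteratedFDeriv {e : OpenPartialHomeomorph M 𝔼}
    (he : e ∈ atlas 𝔼 M) {k : ℕ} (hk : (k : ℕ∞) ≤ r) :
    Continuous fun v : RoofFunction n r M =>
      UniformOnFun.ofFun {K : Set 𝔼 | IsCompact K ∧ K ⊆ e.target}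
        (iteratedFDeriv ℝ k fun z => v.1 (e.symm z)) := by
  have h : @Continuous _ _ (crTopology n r M) _ fun f : C^r⟮𝓡 n, M; ℝ⟯ =>
      UniformOnFun.ofFun {K : Set 𝔼 | IsCompact K ∧ K ⊆ e.target}
        (iteratedFDeriv ℝ k fun z => f (e.symm z)) :=
    continuous_iInf_dom (continuous_iInf_dom (i := he) (continuous_iInf_dom
      (continuous_iInf_dom (i := hk) continuous_induced_dom)))
  exact @Continuous.comp _ _ _ _ (crTopology n r M) _ _ _ h continuous_induced_dom

/-- The sets of `K` where the derivative has norm at most 1/(k+1) decrease to the critical set, so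
one of them has volume < ε. It contains the critical set in `K` of every function whose derivative
is uniformly within 1/(k+1) on `K`. -/
theorem isOpen_volume_criticalSet_lt (hr : 1 ≤ r) [IsManifold (𝓡 n) r M]
    {e : OpenPartialHomeomorph M 𝔼} (he : e ∈ atlas 𝔼 M) {K : Set 𝔼}
    (hK : IsCompact K) (hKe : K ⊆ e.target) (ε : ENNReal) :
    IsOpen {v : RoofFunction n r M | volume (criticalSet e K v.1) < ε} := by
  rw [isOpen_iff_mem_nhds]
  intro v hv
  let Z : ℕ → Set 𝔼 := fun k =>
    {z | z ∈ K ∧ ‖iteratedFDeriv ℝ 1 (fun z => v.1 (e.symm z)) z‖ ≤ 1 / ((k : ℝ) + 1)}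
  have hZ : ⋂ k, Z k = criticalSet e K v.1 := by
    ext z
    simp only [Z, criticalSet, mem_iInter, mem_ofPred_eq]
    constructor
    · intro h
      exact ⟨(h 0).1, ge_of_tendsto' tendsto_one_div_add_atTop_nhds_zero_nat fun k => (h k).2⟩
    · exact fun h k => ⟨h.1, h.2.trans (by positivity)⟩
  have hlim : Tendsto (volume ∘ Z) atTop (𝓝 (volume (⋂ k, Z k))) := by
    refine tendsto_measure_iInter_atTop
      (fun k => (measurableSet_norm_iteratedFDeriv_le hr v.1 he hK hKe _).nullMeasurableSet)
      (fun j k hjk z hz => ⟨hz.1, hz.2.trans (one_div_le_one_div_of_le (by positivity) ?_)⟩)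
      ⟨0, ((measure_mono fun z hz => hz.1).trans_lt hK.measure_lt_top).ne⟩
    gcongr
  rw [hZ] at hlim
  obtain ⟨k, hk⟩ := (hlim.eventually (gt_mem_nhds hv)).exists
  have huc := UniformOnFun.tendsto_iff_tendstoUniformlyOn.1
    ((continuous_roofFunction_iteratedFDeriv he hr).tendsto v) K ⟨hK, hKe⟩
  filter_upwards [Metric.tendstoUniformlyOn_iff.1 huc (1 / ((k : ℝ) + 1)) (by positivity)]
    with v' hv'
  refine (measure_mono ?_).trans_lt hk
  rintro z ⟨hzK, hz⟩
  refine ⟨hzK, ?_⟩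
  have h1 := (hv' z hzK).le
  have h2 := norm_le_zero_iff.1 hz
  simp only [Function.comp_apply, UniformOnFun.toFun_ofFun] at h1
  rwa [show iteratedFDeriv ℝ 1 (fun z => v'.1 (e.symm z)) z = 0 from h2, dist_zero_right] at h1

end Charts

/-! ### Genericity of null critical sets. -/

section Genericity

variable {n : ℕ} {r : ℕ∞} {M : Type*} [TopologicalSpace M]
  [ChartedSpace (EuclideanSpace ℝ (Fin n)) M]

local notation "𝔼" => EuclideanSpace ℝ (Fin n)

/-- Around each closed ball in a chart there is a nonnegative `C^r` function on the manifold
without critical points in that ball. -/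
theorem exists_nonneg_noncritical (hn : 1 ≤ n) [T2Space M] [IsManifold (𝓡 n) r M]
    {e : OpenPartialHomeomorph M 𝔼} (he : e ∈ atlas 𝔼 M) {c : 𝔼} {R : ℝ} (hR : 0 < R)
    (hball : Metric.closedBall c (3 * R) ⊆ e.target) :
    ∃ θ : C^r⟮𝓡 n, M; ℝ⟯, (∀ y, 0 ≤ θ y) ∧
      ∀ z ∈ Metric.closedBall c R, fderiv ℝ (fun z => θ (e.symm z)) z ≠ 0 := by
  let χ : ContDiffBump c := ⟨2 * R, 3 * R, by positivity, by linarith⟩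
  let i : Fin n := ⟨0, hn⟩
  -- The exponential of a coordinate is positive and has no critical point. The cutoff is 1 on the
  -- ball of radius 2R, hence near every point of the ball of radius R.
  let ρ : 𝔼 → ℝ := fun z => χ z * Real.exp (z i)
  have hρ : ContDiff ℝ r ρ := by
    have h1 : ContDiff ℝ r fun z : 𝔼 => z i :=
      (EuclideanSpace.proj i : 𝔼 →L[ℝ] ℝ).contDiff
    exact χ.contDiff.mul h1.exp
  let θ : M → ℝ := e.source.indicator fun y => ρ (e y)
  have hsupp : tsupport θ ⊆ e.source := by
    -- Compact sets are closed in the Hausdorff space `M`; this keeps the support inside the chart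
    -- domain, so the extension by zero is C^r.
    have hcomp : IsCompact (e.symm '' Metric.closedBall c (3 * R)) :=
      (isCompact_closedBall c (3 * R)).image_of_continuousOn (e.continuousOn_symm.mono hball)
    refine (closure_minimal ?_ hcomp.isClosed).trans ?_
    · intro y hy
      have hye : y ∈ e.source := by
        by_contra h
        exact hy (indicator_of_notMem h _)
      refine ⟨e y, ?_, e.left_inv hye⟩
      by_contra h
      refine hy ?_
      have : χ (e y) = 0 := χ.zero_of_le_dist (le_of_lt (not_le.1 h))
      simp [θ, ρ, hye, this]
    · rintro _ ⟨z, hz, rfl⟩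
      exact e.map_target (hball hz)
  have hθ : ContMDiff (𝓡 n) 𝓘(ℝ, ℝ) r θ := by
    refine contMDiff_of_tsupport fun y hy => ?_
    have h1 : ContMDiffAt (𝓡 n) 𝓘(ℝ, ℝ) r (fun y => ρ (e y)) y :=
      hρ.contMDiff.contMDiffAt.comp y ((contMDiffOn_of_mem_maximalAtlas
        (IsManifold.subset_maximalAtlas he)).contMDiffAt (e.open_source.mem_nhds (hsupp hy)))
    refine h1.congr_of_eventuallyEq ?_
    filter_upwards [e.open_source.mem_nhds (hsupp hy)] with y' hy'
    exact indicator_of_mem hy' _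
  refine ⟨⟨θ, hθ⟩, fun y => indicator_nonneg
    (fun y _ => mul_nonneg χ.nonneg (Real.exp_pos _).le) y, fun z hz h0 => ?_⟩
  have hz2 : z ∈ Metric.ball c (2 * R) := Metric.closedBall_subset_ball (by linarith) hz
  have hev : (fun z => θ (e.symm z)) =ᶠ[𝓝 z] fun z => Real.exp (z i) := by
    filter_upwards [Metric.isOpen_ball.mem_nhds hz2] with z' hz'
    have hz't : z' ∈ e.target := hball (Metric.ball_subset_closedBall
      (Metric.ball_subset_ball (by linarith) hz'))
    have h1 : χ z' = 1 := χ.one_of_mem_closedBall (Metric.ball_subset_closedBall hz')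
    simp [θ, ρ, e.map_target hz't, e.right_inv hz't, h1]
  have hd : HasFDerivAt (fun z : 𝔼 => Real.exp (z i))
      (Real.exp (z i) • (EuclideanSpace.proj i : 𝔼 →L[ℝ] ℝ)) z :=
    (EuclideanSpace.proj i : 𝔼 →L[ℝ] ℝ).hasFDerivAt.exp
  change fderiv ℝ (fun z => θ (e.symm z)) z = 0 at h0
  rw [hev.fderiv_eq, hd.fderiv] at h0
  have := DFunLike.congr_fun h0 (EuclideanSpace.single i 1)
  simp at this

/-- The ray `a ↦ v + |a| θ`. -/
noncomputable def RoofFunction.addRay (v : RoofFunction n r M) (θ : C^r⟮𝓡 n, M; ℝ⟯) (hθ : ∀ y, 0 ≤ θ y)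
    (a : ℝ) : RoofFunction n r M :=
  ⟨v.1 + |a| • θ, fun y => add_pos_of_pos_of_nonneg (v.2 y) (mul_nonneg (abs_nonneg a) (hθ y))⟩

/-- Convergence is tested only on compact sets, where the derivatives of `θ` are bounded; `M` need
not be compact. -/
theorem RoofFunction.continuous_addRay [IsManifold (𝓡 n) r M] (v : RoofFunction n r M)
    (θ : C^r⟮𝓡 n, M; ℝ⟯) (hθ : ∀ y, 0 ≤ θ y) : Continuous (v.addRay θ hθ) := by
  refine continuous_induced_rng.2 (continuous_iInf_rng.2 fun e => continuous_iInf_rng.2 fun he =>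
    continuous_iInf_rng.2 fun k => continuous_iInf_rng.2 fun hk => continuous_induced_rng.2 ?_)
  rw [continuous_iff_continuousAt]
  intro a₀
  refine UniformOnFun.tendsto_iff_tendstoUniformlyOn.2 fun K ⟨hK, hKe⟩ => ?_
  have hk' : ((k : ℕ∞) : WithTop ℕ∞) ≤ r := mod_cast hk
  have hD : ∀ a : ℝ, ∀ z ∈ K, iteratedFDeriv ℝ k (fun z => (v.addRay θ hθ a).1 (e.symm z)) z
      = iteratedFDeriv ℝ k (fun z => v.1 (e.symm z)) z
        + |a| • iteratedFDeriv ℝ k (fun z => θ (e.symm z)) z := by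
    intro a z hz
    have h1 : ∀ f : C^r⟮𝓡 n, M; ℝ⟯, ContDiffAt ℝ k (fun z => f (e.symm z)) z := fun f =>
      ((contDiffOn_comp_chart_symm f he).contDiffAt (e.open_target.mem_nhds (hKe hz))).of_le hk'
    rw [← iteratedFDeriv_const_smul_apply (h1 θ)]
    exact iteratedFDeriv_add_apply (h1 v.1) ((h1 θ).const_smul |a|)
  obtain ⟨C, hC⟩ := hK.exists_bound_of_continuousOn
    ((continuousOn_iteratedFDeriv_chart θ he hk).mono hKe)
  rw [Metric.tendstoUniformlyOn_iff]
  intro ε hε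
  have hlim : Tendsto (fun a : ℝ => |(|a₀| - |a|)| * |C|) (𝓝 a₀) (𝓝 0) := by
    have : Continuous fun a : ℝ => |(|a₀| - |a|)| * |C| := by fun_prop
    simpa using this.tendsto a₀
  filter_upwards [hlim.eventually (gt_mem_nhds hε)] with a ha z hz
  refine lt_of_le_of_lt ?_ ha
  change dist (iteratedFDeriv ℝ k (fun z => (v.addRay θ hθ a₀).1 (e.symm z)) z)
    (iteratedFDeriv ℝ k (fun z => (v.addRay θ hθ a).1 (e.symm z)) z) ≤ _
  rw [hD a₀ z hz, hD a z hz, dist_add_left, dist_eq_norm, ← sub_smul, norm_smul, Real.norm_eq_abs]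
  exact mul_le_mul_of_nonneg_left ((hC z hz).trans (le_abs_self C)) (abs_nonneg _)

/-- A common critical point of v + aθ and v + bθ with a ≠ b would be one of θ, and θ has none in the
ball. The critical sets are thus disjoint in a σ-finite space, only countably many have positive
volume, and arbitrarily small a > 0 remain. -/
theorem dense_volume_criticalSet_lt (hn : 1 ≤ n) (hr : 1 ≤ r) [T2Space M]
    [IsManifold (𝓡 n) r M] {e : OpenPartialHomeomorph M 𝔼} (he : e ∈ atlas 𝔼 M) {c : 𝔼} {R : ℝ}
    (hR : 0 < R) (hball : Metric.closedBall c (3 * R) ⊆ e.target) {ε : ENNReal} (hε : 0 < ε) :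
    Dense {v : RoofFunction n r M |
      volume (criticalSet e (Metric.closedBall c R) v.1) < ε} := by
  intro v
  obtain ⟨θ, hθ, hcrit⟩ := exists_nonneg_noncritical (r := r) hn he hR hball
  have hK : IsCompact (Metric.closedBall c R) := isCompact_closedBall c R
  have hKe : Metric.closedBall c R ⊆ e.target :=
    (Metric.closedBall_subset_closedBall (by linarith)).trans hball
  let Z : ℝ → Set 𝔼 := fun a => criticalSet e (Metric.closedBall c R) (v.1 + a • θ)
  have hZ : {a | 0 < volume (Z a)}.Countable := by
    refine Measure.countable_meas_pos_of_disjoint_iUnion (fun a =>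
      measurableSet_norm_iteratedFDeriv_le hr (v.1 + a • θ) he hK hKe 0) fun a b hab => ?_
    refine disjoint_left.2 fun z ha hb => hcrit z ha.1 ?_
    have h1 : ∀ f : C^r⟮𝓡 n, M; ℝ⟯, DifferentiableAt ℝ (fun z => f (e.symm z)) z := fun f =>
      (((contDiffOn_comp_chart_symm f he).contDiffAt (e.open_target.mem_nhds (hKe ha.1))).of_le
        (show ((1 : ℕ∞) : WithTop ℕ∞) ≤ r by exact_mod_cast hr)).differentiableAt one_ne_zero
    have h2 : ∀ a : ℝ, z ∈ Z a → fderiv ℝ (fun z => v.1 (e.symm z)) z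
        + a • fderiv ℝ (fun z => θ (e.symm z)) z = 0 := fun a h => by
      rw [← fderiv_const_smul (h1 θ), ← fderiv_add (h1 v.1) ((h1 θ).const_smul a)]
      have := h.2
      rw [norm_iteratedFDeriv_one] at this
      exact norm_le_zero_iff.1 this
    have h3 : (a - b) • fderiv ℝ (fun z => θ (e.symm z)) z = 0 := by
      rw [sub_smul, sub_eq_zero]
      exact add_left_cancel ((h2 a ha).trans (h2 b hb).symm)
    exact (smul_eq_zero.1 h3).resolve_left (sub_ne_zero.2 hab)
  have hfreq : ∃ᶠ a in 𝓝[>] (0 : ℝ), v.addRay θ hθ a ∈ {v : RoofFunction n r M |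
      volume (criticalSet e (Metric.closedBall c R) v.1) < ε} := by
    refine (nhdsGT_basis (0 : ℝ)).frequently_iff.2 fun δ hδ => ?_
    obtain ⟨a, ha, haδ⟩ := (hZ.dense_compl ℝ).exists_between hδ
    refine ⟨a, haδ, ?_⟩
    have h0 : volume (Z a) = 0 := by simpa using ha
    change volume (criticalSet e (Metric.closedBall c R) (v.1 + |a| • θ)) < ε
    rw [abs_of_pos haδ.1]
    exact h0.symm ▸ hε
  have hlim : Tendsto (v.addRay θ hθ) (𝓝[>] 0) (𝓝 v) := by
    have h := ((v.continuous_addRay θ hθ).tendsto 0).mono_left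
      (nhdsWithin_le_nhds (s := Ioi (0 : ℝ)))
    have h0 : v.addRay θ hθ 0 = v := by
      refine Subtype.ext ?_
      simp [RoofFunction.addRay]
    rwa [h0] at h
  exact mem_closure_of_frequently_of_tendsto hfreq hlim

/-- The critical set of a generic roof function is negligible in a given ball of a chart. -/
theorem eventually_residual_volume_criticalSet_eq_zero (hn : 1 ≤ n) (hr : 1 ≤ r) [T2Space M]
    [IsManifold (𝓡 n) r M] {e : OpenPartialHomeomorph M 𝔼} (he : e ∈ atlas 𝔼 M) {c : 𝔼} {R : ℝ}
    (hR : 0 < R) (hball : Metric.closedBall c (3 * R) ⊆ e.target) :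
    ∀ᶠ v in residual (RoofFunction n r M),
      volume (criticalSet e (Metric.closedBall c R) v.1) = 0 := by
  have hKe : Metric.closedBall c R ⊆ e.target :=
    (Metric.closedBall_subset_closedBall (by linarith)).trans hball
  have h : ∀ k : ℕ, ∀ᶠ v in residual (RoofFunction n r M),
      volume (criticalSet e (Metric.closedBall c R) v.1) < ((k : ENNReal) + 1)⁻¹ := fun k =>
    residual_of_dense_open (isOpen_volume_criticalSet_lt hr he (isCompact_closedBall c R) hKe _)
      (dense_volume_criticalSet_lt hn hr he hR hball (by simp))
  filter_upwards [eventually_countable_forall.2 h] with v hv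
  refine le_antisymm (ENNReal.le_of_forall_pos_le_add fun ε hε _ => ?_) (zero_le)
  obtain ⟨k, hk⟩ := ENNReal.exists_inv_nat_lt (ENNReal.coe_pos.2 hε).ne'
  rw [zero_add]
  refine (hv k).le.trans (le_trans ?_ hk.le)
  exact ENNReal.inv_le_inv.2 le_self_add

/-- For a generic roof function, the image of an absolutely continuous measure is absolutely
continuous. -/
theorem eventually_residual_map_absolutelyContinuous (hn : 1 ≤ n) (hr : 1 ≤ r) [T2Space M]
    [SecondCountableTopology M] [IsManifold (𝓡 n) r M] [MeasurableSpace M] [BorelSpace M] :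
    ∀ᶠ v in residual (RoofFunction n r M), ∀ m : Measure M,
      AbsolutelyContinuousLebesgue n m → m.map v.1 ≪ volume := by
  have hR : ∀ x : M, ∃ R : ℝ, 0 < R ∧
      Metric.closedBall (chartAt 𝔼 x x) (3 * R) ⊆ (chartAt 𝔼 x).target := fun x => by
    obtain ⟨R, hR, h⟩ := Metric.nhds_basis_closedBall.mem_iff.1
      ((chartAt 𝔼 x).open_target.mem_nhds (mem_chart_target 𝔼 x))
    exact ⟨R / 3, by positivity, by rwa [mul_div_cancel₀ _ (three_ne_zero)]⟩
  choose R hR hball using hR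
  let O : M → Set M := fun x =>
    (chartAt 𝔼 x).source ∩ chartAt 𝔼 x ⁻¹' Metric.closedBall (chartAt 𝔼 x x) (R x)
  obtain ⟨J, hJ, hO⟩ := TopologicalSpace.countable_cover_nhds (f := O) fun x =>
    inter_mem (chart_source_mem_nhds 𝔼 x)
      (((chartAt 𝔼 x).continuousAt (mem_chart_source 𝔼 x)).preimage_mem_nhds
        (Metric.closedBall_mem_nhds _ (hR x)))
  have h := (eventually_countable_ball hJ).2 fun x _ =>
    eventually_residual_volume_criticalSet_eq_zero (r := r) hn hr (chart_mem_atlas 𝔼 x)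
      (hR x) (hball x)
  -- The condition on `v` does not involve `m`: one residual set serves all measures.
  filter_upwards [h] with v hv m hm
  refine Measure.AbsolutelyContinuous.mk fun N hN hN0 => ?_
  rw [Measure.map_apply v.1.contMDiff.continuous.measurable hN]
  refine hm _ (lebesgueNull_of_countable_cover hr hJ hO (fun x => inter_subset_left)
    fun x hx => ?_)
  have hu : ContDiffOn ℝ 1 (fun z => v.1 ((chartAt 𝔼 x).symm z)) (chartAt 𝔼 x).target :=
    (contDiffOn_comp_chart_symm v.1 (chart_mem_atlas 𝔼 x)).of_le
      (show ((1 : ℕ∞) : WithTop ℕ∞) ≤ r by exact_mod_cast hr)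
  -- Critical points in the ball are null by genericity, the others by the submersion argument.
  refine measure_mono_null ?_ (measure_union_null (hv x hx)
    (volume_preimage_inter_fderiv_ne_zero volume (chartAt 𝔼 x).open_target hu hN0))
  rintro _ ⟨y, ⟨hyN, hyx, hyR⟩, rfl⟩
  have hinv := (chartAt 𝔼 x).left_inv hyx
  by_cases h0 : fderiv ℝ (fun z => v.1 ((chartAt 𝔼 x).symm z)) (chartAt 𝔼 x y) = 0
  · exact .inl ⟨hyR, by rw [norm_iteratedFDeriv_one, h0, norm_zero]⟩
  · exact .inr ⟨(chartAt 𝔼 x).map_source hyx, by rwa [hinv], h0⟩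

end Genericity

theorem measurePreservingSemiflow_translate {A : Type*} [MeasurableSpace A] {ν : Measure A}
    [IsProbabilityMeasure ν] {T : A → A} (hT : MeasurePreserving T ν ν) :
    MeasurePreservingSemiflow (suspensionMeasure T ν) (Suspension.translate T) :=
  ⟨Suspension.measurable_translate hT.measurable, Suspension.translate_add T,
    measurePreserving_translate hT⟩

end StretchedBirkhoff

theorem mainTheorem9 {A : Type*} [MeasurableSpace A] (ν : MeasureTheory.Measure A)
    [MeasureTheory.IsProbabilityMeasure ν] (T : A → A)
    (hT : MeasureTheory.MeasurePreserving T ν ν)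
    (n : ℕ) (hn : 1 ≤ n) (r : ℕ∞) (hr : 1 ≤ r)
    {M : Type*} [TopologicalSpace M] [T2Space M] [SecondCountableTopology M]
    [ChartedSpace (EuclideanSpace ℝ (Fin n)) M] [IsManifold (𝓡 n) r M]
    [MeasurableSpace M] [BorelSpace M] :
    ∀ᶠ v in residual (StretchedBirkhoff.RoofFunction n r M),
      ∀ μ : MeasureTheory.Measure (StretchedBirkhoff.Suspension T × M),
        StretchedBirkhoff.IsAbsolutelyContinuousCompatible n T ν μ →
          StretchedBirkhoff.KeplerianShear μ (StretchedBirkhoff.stretchedFlow T v) := by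
  filter_upwards [StretchedBirkhoff.eventually_residual_map_absolutelyContinuous hn hr]
    with v hv μ hμ
  obtain ⟨m, hm, hac, rfl⟩ := hμ
  have hw : Measurable v.speed :=
    measurable_real_toNNReal.comp v.1.contMDiff.continuous.measurable
  have hmap : (fun y => (v.speed y : ℝ)) = v.1 :=
    funext fun y => Real.coe_toNNReal _ (v.2 y).le
  exact (StretchedBirkhoff.measurePreservingSemiflow_translate hT).keplerianShear hw
    (hmap ▸ hv m hac)
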